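/- Let $S=\{(x,y)\in\mathbb C^2 : y^3-x^2=0\}$, and for $x\in\mathbb C$ let $K(x)=\{y : (x,y)\in S\}$ and $N=\{x : |K(x)|<3\}$. Let $r>0$, let $E$ be the closed disc of radius $r$ about $0$, let $D\subset\mathbb C$ be any closed disc that contains $K(x)$ for all $x\in E$, and let $M\in\partial E$. The braid group $B_3$ on three strings in $D$ based at the three-point set $K(M)$ is the fundamental group, based at $K(M)$, of the space of three-element subsets of $D$ (with the quotient topology from ordered triples of distinct points); products $ab$ of loops mean "first $a$, then $b$". The braid monodromy $\varphi:\pi_1(E\setminus N,M)\to B_3$ sends the class of a loop $\gamma$ to the class of the loop $t\mapsto K(\gamma(t))$, which is traced out by the second coordinates of the three lifts of $\gamma$ to $S$. Let $c$ be any number with $c^3=M^2$, put $\omega=e^{2\pi i/3}$, so that $K(M)=\{c\omega^2,c\omega,c\}$, and let $\sigma_1$, $\sigma_2\in B_3$ be the positive (counterclockwise) half-twists along the straight segments $[c\omega^2,c\omega]$ and $[c\omega,c]$. (For $M=r$ and $c=r^{2/3}>0$ these are the standard Artin generators: after a small clockwise rotation the points $c\omega^2,c\omega,c$ are listed by increasing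 real part.) Then the local braid monodromy of $S$ at the origin is generated by $(\sigma_1\sigma_2)^2$: for the loop $\Gamma(t)=e^{2\pi i t}M$, $t\in[0,1]$, $$\varphi([\Gamma])=(\sigma_1\sigma_2)^2,$$ and the image of $\varphi$ is the cyclic subgroup of $B_3$ generated by $(\sigma_1\sigma_2)^2$. -/

import Mathlib

open scoped Topology

namespace BraidMonodromy

noncomputable section

/-! ### Fundamental groups with the concatenation product -/

/-- The fundamental group `π₁(X, x)` in which `a * b` means "first `a`, then `b`".
Mathlib's `FundamentalGroup` multiplies in the order of composition of functions, hence the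
opposite group is taken. -/
abbrev PiOne (X : Type*) [TopologicalSpace X] (x : X) : Type _ := (FundamentalGroup X x)ᵐᵒᵖ

/-- The class of a loop. -/
def PiOne.mk {X : Type*} [TopologicalSpace X] {x : X} (γ : Path x x) : PiOne X x :=
  MulOpposite.op (FundamentalGroup.fromPath (Path.Homotopic.Quotient.mk γ))

theorem PiOne.mk_mul_mk {X : Type*} [TopologicalSpace X] {x : X} (γ δ : Path x x) :
    PiOne.mk γ * PiOne.mk δ = PiOne.mk (γ.trans δ) := rfl

/-! ### Configuration spaces and geometric braids -/

/-- Ordered `n`-tuples of pairwise distinct points of `D`. -/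
def OConf (n : ℕ) (D : Set ℂ) : Type :=
  {f : Fin n → ℂ // Function.Injective f ∧ ∀ i, f i ∈ D}

instance (n : ℕ) (D : Set ℂ) : TopologicalSpace (OConf n D) :=
  inferInstanceAs (TopologicalSpace {f : Fin n → ℂ // Function.Injective f ∧ ∀ i, f i ∈ D})

/-- The `n`-element subsets of `D`. -/
def UConf (n : ℕ) (D : Set ℂ) : Type :=
  {s : Set ℂ // s ⊆ D ∧ s.encard = n}

/-- Forgetting the order of the points. -/
def OConf.toUConf {n : ℕ} {D : Set ℂ} (f : OConf n D) : UConf n D :=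
  ⟨Set.range f.1, by
    rintro _ ⟨i, rfl⟩
    exact f.2.2 i, by
    rw [← Set.image_univ, f.2.1.encard_image, Set.encard_univ]
    simp⟩

/-- The unordered configuration space of `n` points of `D`: the quotient topology of the ordered
one by the permutations of the points. -/
instance (n : ℕ) (D : Set ℂ) : TopologicalSpace (UConf n D) :=
  TopologicalSpace.coinduced OConf.toUConf inferInstance

/-- The braid group on `n` strings in `D`, based at the configuration `κ`: homotopy classes of
motions of `n` distinct points of `D` that begin and end at `κ`. The product `a * b` is
"first `a`, then `b`". -/
abbrev BraidGroup (n : ℕ) (D : Set ℂ) (κ : UConf n D) : Type _ := PiOne (UConf n D) κ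

/-- `IsHalfTwist κ p q b`: the braid `b` is the positive half-twist along the straight segment
joining the points `p` and `q` of `κ`. The segment meets `κ` only in its end points, the points
`p` and `q` are exchanged counterclockwise along the boundary of a lens around the segment, and
the other points of `κ` stay fixed. All sufficiently thin lenses are required to give `b`, so `b`
is determined by `κ`, `p` and `q`. -/
def IsHalfTwist {n : ℕ} {D : Set ℂ} (κ : UConf n D) (p q : ℂ) (b : BraidGroup n D κ) : Prop :=
  p ≠ q ∧ segment ℝ p q ∩ κ.1 = {p, q} ∧
  ∀ᶠ ε : ℝ in 𝓝[>] 0, ∃ γ : Path κ κ,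
    (∀ t : unitInterval, (γ t).1 = (κ.1 \ {p, q}) ∪
      {p + (q - p) * ((t : ℝ) - Complex.I * (ε * Real.sin (Real.pi * t) : ℝ)),
       q - (q - p) * ((t : ℝ) - Complex.I * (ε * Real.sin (Real.pi * t) : ℝ))}) ∧
    b = PiOne.mk γ

/-! ### Braid monodromy of a plane curve -/

/-- `K(x)`: the second coordinates of the points of `S` above `x`. -/
def fiber (S : Set (ℂ × ℂ)) (x : ℂ) : Set ℂ := {y | (x, y) ∈ S}

/-- `N(S)`: the points over which `S` has fewer than `n` points. -/
def branchLocus (S : Set (ℂ × ℂ)) (n : ℕ) : Set ℂ := {x | (fiber S x).encard < n}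

/-- The map `x ↦ K(x)` from `E \ N` to the configuration space of `D`, for a curve `S` of degree
at most `n` over the first coordinate with `S` contained in `E × D` above `E`. -/
def fiberConf (S : Set (ℂ × ℂ)) (n : ℕ) (E D : Set ℂ)
    (hn : ∀ x, (fiber S x).encard ≤ n) (hD : ∀ p ∈ S, p.1 ∈ E → p.2 ∈ D)
    (x : ↥(E \ branchLocus S n)) : UConf n D :=
  ⟨fiber S x, fun _ hy => hD _ hy x.2.1, le_antisymm (hn x) (not_lt.1 x.2.2)⟩

/-- The braid monodromy `π₁(E \ N, M) → Bₙ` of `S` with respect to `E × D`. It sends the class of a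
loop `γ` to the class of the motion `t ↦ K(γ(t))`, which is performed by the second coordinates of
the `n` lifts of `γ` to `S`. -/
def braidMonodromy (S : Set (ℂ × ℂ)) (n : ℕ) (E D : Set ℂ)
    (hn : ∀ x, (fiber S x).encard ≤ n) (hD : ∀ p ∈ S, p.1 ∈ E → p.2 ∈ D)
    (hc : Continuous (fiberConf S n E D hn hD)) (M : ↥(E \ branchLocus S n)) :
    PiOne ↥(E \ branchLocus S n) M →* BraidGroup n D (fiberConf S n E D hn hD M) :=
  MonoidHom.op (FundamentalGroup.map ⟨fiberConf S n E D hn hD, hc⟩ M)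

theorem braidMonodromy_mk (S : Set (ℂ × ℂ)) (n : ℕ) (E D : Set ℂ)
    (hn : ∀ x, (fiber S x).encard ≤ n) (hD : ∀ p ∈ S, p.1 ∈ E → p.2 ∈ D)
    (hc : Continuous (fiberConf S n E D hn hD)) (M : ↥(E \ branchLocus S n)) (γ : Path M M) :
    braidMonodromy S n E D hn hD hc M (PiOne.mk γ) = PiOne.mk (γ.map hc) := rfl

/-! ### The curve `y³ - x² = 0` -/

/-- The curve `y³ - x² = 0`. -/
def cuspCurve : Set (ℂ × ℂ) := {p | p.2 ^ 3 - p.1 ^ 2 = 0}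

/-- The primitive cube root of unity `exp(2πi/3)`. -/
def ω : ℂ := Complex.exp (2 * Real.pi * Complex.I / 3)

theorem ω_isPrimitiveRoot : IsPrimitiveRoot ω 3 :=
  Complex.isPrimitiveRoot_exp 3 (by norm_num)

theorem cube_root_injective {c : ℂ} (hc : c ≠ 0) :
    Function.Injective fun i : Fin 3 => c * ω ^ (i : ℕ) := by
  intro i j h
  exact Fin.ext (ω_isPrimitiveRoot.pow_inj i.2 j.2 (mul_left_cancel₀ hc h))

theorem fiber_cusp {c x : ℂ} (hx : x ≠ 0) (h : c ^ 3 = x ^ 2) :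
    fiber cuspCurve x = Set.range fun i : Fin 3 => c * ω ^ (i : ℕ) := by
  have hc : c ≠ 0 := by
    rintro rfl
    exact hx (by simpa using h.symm)
  ext y
  simp only [fiber, cuspCurve, Set.mem_ofPred_eq, Set.mem_range]
  constructor
  · intro hy
    have h1 : (y / c) ^ 3 = 1 := by
      rw [div_pow, h, sub_eq_zero.1 hy, div_self (pow_ne_zero 2 hx)]
    obtain ⟨i, hi, h2⟩ := ω_isPrimitiveRoot.eq_pow_of_pow_eq_one h1
    exact ⟨⟨i, hi⟩, by simp only [h2]; field_simp⟩
  · rintro ⟨i, rfl⟩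
    rw [mul_pow, h, ← pow_mul, mul_comm (i : ℕ) 3, pow_mul, ω_isPrimitiveRoot.pow_eq_one]
    simp

theorem exists_cube_root (x : ℂ) : ∃ c : ℂ, c ^ 3 = x ^ 2 :=
  IsAlgClosed.exists_pow_nat_eq _ (by norm_num)

theorem fiber_cusp_encard {x : ℂ} (hx : x ≠ 0) : (fiber cuspCurve x).encard = (3 : ℕ) := by
  obtain ⟨c, h⟩ := exists_cube_root x
  have hc : c ≠ 0 := by
    rintro rfl
    exact hx (by simpa using h.symm)
  rw [fiber_cusp hx h, ← Set.image_univ, (cube_root_injective hc).encard_image, Set.encard_univ]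
  simp

theorem fiber_cusp_zero : fiber cuspCurve 0 = {0} := by
  ext y
  simp [fiber, cuspCurve]

theorem fiber_cusp_encard_le (x : ℂ) : (fiber cuspCurve x).encard ≤ (3 : ℕ) := by
  by_cases hx : x = 0
  · rw [hx, fiber_cusp_zero, Set.encard_singleton]
    norm_num
  · exact (fiber_cusp_encard hx).le

theorem branchLocus_cusp : branchLocus cuspCurve 3 = {0} := by
  ext x
  simp only [branchLocus, Set.mem_ofPred_eq, Set.mem_singleton_iff]
  constructor
  · intro h
    by_contra hx
    exact (fiber_cusp_encard hx ▸ h).ne rfl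
  · rintro rfl
    rw [fiber_cusp_zero, Set.encard_singleton]
    norm_num

theorem ne_zero_of_mem {E : Set ℂ} (x : ↥(E \ branchLocus cuspCurve 3)) : (x : ℂ) ≠ 0 := by
  intro h
  exact x.2.2 (branchLocus_cusp.superset h)

theorem continuous_fiberConf_cusp (E D : Set ℂ) (hD : ∀ p ∈ cuspCurve, p.1 ∈ E → p.2 ∈ D) :
    Continuous (fiberConf cuspCurve 3 E D fiber_cusp_encard_le hD) := by
  rw [continuous_iff_continuousAt]
  intro x₀
  obtain ⟨c, hc⟩ := exists_cube_root (x₀ : ℂ)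
  have hx₀ := ne_zero_of_mem x₀
  -- a cube root of `x²` near `x₀`
  let g : ↥(E \ branchLocus cuspCurve 3) → ℂ :=
    fun x => c * ((x : ℂ) ^ 2 / (x₀ : ℂ) ^ 2) ^ ((3 : ℕ)⁻¹ : ℂ)
  have hg : ∀ x, g x ^ 3 = (x : ℂ) ^ 2 := by
    intro x
    simp only [g]
    rw [mul_pow, Complex.cpow_nat_inv_pow _ (by norm_num), hc]
    field_simp
  have hg0 : ∀ x, g x ≠ 0 := by
    intro x h
    have := hg x
    rw [h] at this
    exact ne_zero_of_mem x (by simpa using this.symm)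
  let G : ↥(E \ branchLocus cuspCurve 3) → OConf 3 D := fun x =>
    ⟨fun i => g x * ω ^ (i : ℕ), cube_root_injective (hg0 x), fun i => by
      have h1 : g x * ω ^ (i : ℕ) ∈ fiber cuspCurve x := by
        rw [fiber_cusp (ne_zero_of_mem x) (hg x)]
        exact ⟨i, rfl⟩
      exact hD _ h1 x.2.1⟩
  have hG : fiberConf cuspCurve 3 E D fiber_cusp_encard_le hD = OConf.toUConf ∘ G := by
    funext x
    exact Subtype.ext (fiber_cusp (ne_zero_of_mem x) (hg x))
  have hgc : ContinuousAt g x₀ := by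
    refine continuousAt_const.mul (ContinuousAt.cpow ?_ continuousAt_const ?_)
    · fun_prop
    · rw [div_self (pow_ne_zero 2 hx₀)]
      exact Complex.one_mem_slitPlane
  have hGc : ContinuousAt G x₀ := by
    refine Topology.IsInducing.subtypeVal.continuousAt_iff.2 ?_
    exact continuousAt_pi.2 fun i => hgc.mul continuousAt_const
  rw [hG]
  exact (continuous_coinduced_rng.continuousAt).comp hGc

/-- The loop `t ↦ exp(2πit) M`, running once counterclockwise around the origin in the
complement of `N` in the closed disc of radius `r` about `0`. -/
def cuspLoop {r : ℝ} (M : ↥(Metric.closedBall (0 : ℂ) r \ branchLocus cuspCurve 3)) :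
    Path M M where
  toFun t := ⟨Complex.exp (2 * Real.pi * Complex.I * ((t : ℝ) : ℂ)) * M, by
    have hn : ‖Complex.exp (2 * Real.pi * Complex.I * ((t : ℝ) : ℂ))‖ = 1 := by
      rw [Complex.norm_exp]
      simp
    refine ⟨?_, ?_⟩
    · have := M.2.1
      rw [mem_closedBall_zero_iff] at this ⊢
      rwa [norm_mul, hn, one_mul]
    · intro h
      have h0 : Complex.exp (2 * Real.pi * Complex.I * ((t : ℝ) : ℂ)) * (M : ℂ) = 0 :=
        branchLocus_cusp.subset h
      exact mul_ne_zero (Complex.exp_ne_zero _) (ne_zero_of_mem M) h0⟩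
  continuous_toFun := by fun_prop
  source' := Subtype.ext (by simp)
  target' := Subtype.ext (by simp)

end

end BraidMonodromy

namespace BraidMonodromy

open unitInterval Set

noncomputable section

/-! ### Motions given by lifts to ordered tuples -/

/-! Over `exp(2πit) M` the fibre consists of the cube roots of `exp(4πit) M²`. The braid of the loop
therefore turns the equilateral triangle `K(M)` rigidly by `4π/3`, that is, twice by `2π/3`
(`cuspLoop_map`).

The rotation by `2π/3` is `σ₁σ₂` (`twist_trans_twist_homotopic`). Suitably labelled, both motions
lift to ordered triples with the same end points, and the straight-line homotopy between the lifts
has no collisions (`homotopic_of_lifts`). This is checked pair by pair: the two difference vectors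
of a pair lie in a common closed half plane and are never opposite (`convexComb_ne_zero`).

For the image, the loop generates the fundamental group of the punctured disc
(`zpowers_mk_cuspLoop`), because `exp` covers that disc by a convex half plane. All motions have
room in `D`, which contains the disc of radius `‖c‖` (`closedBall_subset_of_cusp`). -/

theorem continuous_toUConf (n : ℕ) (D : Set ℂ) :
    Continuous (OConf.toUConf : OConf n D → UConf n D) :=
  continuous_coinduced_rng

/-- Two motions are homotopic if they lift to motions of ordered tuples that start and end at the
same tuples, and between which the straight-line homotopy has no collisions. -/
theorem homotopic_of_lifts {n : ℕ} {D : Set ℂ} (hD : Convex ℝ D) {κ κ' : UConf n D}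
    {γ δ : Path κ κ'} {f g : I → Fin n → ℂ} (hf : Continuous f) (hg : Continuous g)
    (hγ : ∀ t, (γ t).1 = range (f t)) (hδ : ∀ t, (δ t).1 = range (g t))
    (h0 : f 0 = g 0) (h1 : f 1 = g 1)
    (hinj : ∀ s t : I, Function.Injective fun i => (1 - (s : ℝ) : ℂ) * f t i + (s : ℝ) * g t i) :
    γ.Homotopic δ := by
  have hmem : ∀ (s t : I) i, (1 - (s : ℝ) : ℂ) * f t i + (s : ℝ) * g t i ∈ D := by
    intro s t i
    have h1 : f t i ∈ D := (γ t).2.1 (hγ t ▸ mem_range_self i)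
    have h2 : g t i ∈ D := (δ t).2.1 (hδ t ▸ mem_range_self i)
    have := hD h1 h2 (sub_nonneg.2 s.2.2) s.2.1 (by ring)
    simpa using this
  let H : I × I → OConf n D := fun p =>
    ⟨fun i => (1 - (p.1 : ℝ) : ℂ) * f p.2 i + (p.1 : ℝ) * g p.2 i, hinj p.1 p.2, hmem p.1 p.2⟩
  have hH : Continuous H := by
    refine Continuous.subtype_mk (continuous_pi fun i => ?_) _
    have hfi : Continuous fun t => f t i := (continuous_apply i).comp hf
    have hgi : Continuous fun t => g t i := (continuous_apply i).comp hg
    fun_prop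
  have hval : ∀ p, (OConf.toUConf (H p)).1 =
      range fun i => (1 - (p.1 : ℝ) : ℂ) * f p.2 i + (p.1 : ℝ) * g p.2 i := fun _ => rfl
  refine ⟨⟨⟨⟨fun p => OConf.toUConf (H p), (continuous_toUConf n D).comp hH⟩, ?_, ?_⟩, ?_⟩⟩
  · intro t
    exact Subtype.ext (by simp [hval, hγ])
  · intro t
    exact Subtype.ext (by simp [hval, hδ])
  · rintro s t (rfl | rfl)
    · refine Subtype.ext ((hval _).trans ((hγ 0).trans ?_).symm)
      congr 1
      funext i
      simp only [← h0]
      ring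
    · refine Subtype.ext ((hval _).trans ((hγ 1).trans ?_).symm)
      congr 1
      funext i
      simp only [← h1]
      ring

/-- The motion given by a motion of ordered tuples. -/
def pathOfLift {n : ℕ} {D : Set ℂ} {κ κ' : UConf n D} (f : I → Fin n → ℂ) (hf : Continuous f)
    (hinj : ∀ t, Function.Injective (f t)) (hmem : ∀ t i, f t i ∈ D)
    (h0 : range (f 0) = κ.1) (h1 : range (f 1) = κ'.1) : Path κ κ' where
  toFun t := OConf.toUConf ⟨f t, hinj t, hmem t⟩
  continuous_toFun := (continuous_toUConf n D).comp (hf.subtype_mk _)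
  source' := Subtype.ext h0
  target' := Subtype.ext h1

theorem injective_vecThree {a b c : ℂ} (hab : a - b ≠ 0) (hbc : b - c ≠ 0) (hca : c - a ≠ 0) :
    Function.Injective ![a, b, c] := by
  have hab' := sub_ne_zero.1 hab
  have hbc' := sub_ne_zero.1 hbc
  have hca' := sub_ne_zero.1 hca
  intro i j h
  fin_cases i <;> fin_cases j <;> simp_all

theorem range_vecThree (a b c : ℂ) : range ![a, b, c] = {a, b, c} := by
  ext x
  simp only [mem_range, Fin.exists_fin_succ, mem_insert_iff, mem_singleton_iff]
  simp [eq_comm]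

/-! ### The cube root of unity -/

theorem ω_eq : ω = ⟨-1 / 2, √3 / 2⟩ := by
  have h : (2 * Real.pi * Complex.I / 3 : ℂ) = ((Real.pi - Real.pi / 3 : ℝ) : ℂ) * Complex.I := by
    push_cast
    ring
  rw [ω, h, Complex.exp_mul_I, ← Complex.ofReal_cos, ← Complex.ofReal_sin, Real.cos_pi_sub,
    Real.sin_pi_sub, Real.cos_pi_div_three, Real.sin_pi_div_three]
  apply Complex.ext <;> simp
  norm_num

theorem ω_re : ω.re = -1 / 2 := by rw [ω_eq]

theorem ω_im : ω.im = √3 / 2 := by rw [ω_eq]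

theorem ω_sq : ω ^ 2 = -1 - ω := by
  have h : √3 * √3 = 3 := Real.mul_self_sqrt (by norm_num)
  apply Complex.ext
  · simp only [sq, Complex.mul_re, Complex.sub_re, Complex.neg_re, Complex.one_re, ω_re, ω_im]
    linarith
  · simp only [sq, Complex.mul_im, Complex.sub_im, Complex.neg_im, Complex.one_im, ω_re, ω_im]
    ring

theorem ω_pow_three : ω ^ 3 = 1 := ω_isPrimitiveRoot.pow_eq_one

theorem norm_ω : ‖ω‖ = 1 :=
  ω_isPrimitiveRoot.norm'_eq_one (by norm_num)

theorem fiber_cusp_eq {c x : ℂ} (hx : x ≠ 0) (h : c ^ 3 = x ^ 2) :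
    fiber cuspCurve x = {c, c * ω, c * ω ^ 2} := by
  rw [fiber_cusp hx h, ← range_vecThree]
  congr 1
  funext i
  fin_cases i <;> simp

/-! ### Lenses -/

/-- The arc from `p` to `q` that bounds a lens around the segment `[p, q]`, on the right. -/
def lens (p q : ℂ) (ε : ℝ) : Path p q where
  toFun t := p + (q - p) * ((t : ℝ) - Complex.I * (ε * Real.sin (Real.pi * t) : ℝ))
  continuous_toFun := by fun_prop
  source' := by simp
  target' := by simp

theorem lens_apply (p q : ℂ) (ε : ℝ) (t : I) :
    lens p q ε t = p + (q - p) * ((t : ℝ) - Complex.I * (ε * Real.sin (Real.pi * t) : ℝ)) := rfl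

/-- By this equivariance one side of the standard triangle serves for all sides of all triangles. -/
theorem lens_mul (d p q : ℂ) (ε : ℝ) (t : I) : lens (d * p) (d * q) ε t = d * lens p q ε t := by
  simp only [lens_apply]
  ring

theorem sin_pi_nonneg (t : I) : 0 ≤ Real.sin (Real.pi * t) :=
  Real.sin_nonneg_of_nonneg_of_le_pi (by have := Real.pi_pos; have := t.2.1; positivity)
    (mul_le_of_le_one_right Real.pi_pos.le t.2.2)

/-- The sine is at most `π min(t, 1 - t)`, where `π ≤ 4` and `max(t, 1 - t) ≥ 1/2`. The form `t(1 -
t)` matches the gap between a chord and the unit circle. -/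
theorem sin_pi_le (t : I) : Real.sin (Real.pi * t) ≤ 8 * (t * (1 - t)) := by
  have hp := Real.pi_pos
  have hp4 := Real.pi_le_four
  have h0 := t.2.1
  have h1 := t.2.2
  have h2 : Real.sin (Real.pi * t) ≤ Real.pi * t := Real.sin_le (by positivity)
  have h3 : Real.sin (Real.pi * t) ≤ Real.pi * (1 - t) := by
    rw [← Real.sin_pi_sub, show Real.pi - Real.pi * t = Real.pi * (1 - t) by ring]
    exact Real.sin_le (mul_nonneg hp.le (by linarith))
  rcases le_total (t : ℝ) (1 / 2) with h | h <;> nlinarith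

theorem sqrt_three_bounds : 0 < √3 ∧ √3 * √3 = 3 ∧ 1.7 < √3 ∧ √3 < 1.8 :=
  ⟨by positivity, Real.mul_self_sqrt (by norm_num), Real.lt_sqrt_of_sq_lt (by norm_num),
    (Real.sqrt_lt' (by norm_num)).2 (by norm_num)⟩

/-- The chord has length `√3` and distance `1/2` from the origin. Its point at time `t` has squared
norm `1 - 3t(1 - t)`, and the bulge of the lens adds `∓√3 η + 3η²`, which `key` bounds. -/
theorem norm_lens_le {ε : ℝ} (h0 : 0 ≤ ε) (h1 : ε ≤ 1 / 10) (t : I) :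
    ‖lens ω 1 ε t‖ ≤ 1 ∧ ‖lens 1 ω ε t‖ ≤ 1 := by
  obtain ⟨hs, hs2, hs3, hs4⟩ := sqrt_three_bounds
  have ht0 := t.2.1
  have ht1 := t.2.2
  have ha := sin_pi_nonneg t
  have hb := sin_pi_le t
  have hc := Real.sin_le_one (Real.pi * t)
  set η := ε * Real.sin (Real.pi * t) with hη
  have hη0 : 0 ≤ η := mul_nonneg h0 ha
  have hη1 : η ≤ 8 / 10 * (t * (1 - t)) := by nlinarith
  have hη2 : η ≤ 1 / 10 := by nlinarith
  have key : √3 * η + 3 * η ^ 2 ≤ 3 * (t * (1 - t)) := by nlinarith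
  have hneg : 0 ≤ √3 * η := by positivity
  constructor <;> rw [← sq_le_one_iff₀ (norm_nonneg _), Complex.sq_norm, Complex.normSq_apply] <;>
    simp [lens_apply, ω_re, ω_im, ← hη, -Complex.ofReal_mul] <;> nlinarith

/-! ### Half-twists along the sides of an equilateral triangle -/

/-- A straight-line homotopy between two lenses runs through lenses of intermediate thickness. -/
theorem lens_convexComb (p q : ℂ) (ε ε' s : ℝ) (t : I) :
    (1 - (s : ℝ) : ℂ) * lens p q ε t + (s : ℝ) * lens p q ε' t =
      lens p q ((1 - s) * ε + s * ε') t := by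
  simp only [lens_apply]
  push_cast
  ring

/-- The motion of the three cube roots of unity that exchanges `ω` and `1` along a lens. -/
def twistTuple (ε : ℝ) (t : I) : Fin 3 → ℂ := ![lens ω 1 ε t, lens 1 ω ε t, ω ^ 2]

theorem continuous_twistTuple (ε : ℝ) : Continuous (twistTuple ε) := by
  refine continuous_pi fun i => ?_
  fin_cases i
  · exact (lens ω 1 ε).continuous
  · exact (lens 1 ω ε).continuous
  · exact continuous_const

theorem twistTuple_injective {ε : ℝ} (h0 : 0 < ε) (h1 : ε ≤ 1 / 10) (t : I) :
    Function.Injective (twistTuple ε t) := by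
  obtain ⟨hs, hs2, hs3, hs4⟩ := sqrt_three_bounds
  have ht0 := t.2.1
  have ht1 := t.2.2
  have ha := sin_pi_nonneg t
  have hc := Real.sin_le_one (Real.pi * t)
  have hη0 : 0 ≤ ε * Real.sin (Real.pi * t) := mul_nonneg h0.le ha
  have hη2 : ε * Real.sin (Real.pi * t) ≤ 1 / 10 := by nlinarith
  refine injective_vecThree ?_ ?_ ?_
  · intro h
    have h2 : lens ω 1 ε t - lens 1 ω ε t =
        (ω - 1) * (1 - 2 * ((t : ℝ) - Complex.I * (ε * Real.sin (Real.pi * t) : ℝ))) := by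
      simp only [lens_apply]
      ring
    rw [h2] at h
    rcases mul_eq_zero.1 h with h | h
    · have := congrArg Complex.im h
      simp [ω_im] at this
    -- The exchanged points could meet only at half time, where the lens has its full thickness `ε >
    -- 0`.
    · have h3 : (t : ℝ) = 1 / 2 := by
        have := congrArg Complex.re h
        simp [-Complex.ofReal_mul] at this
        linarith
      have h4 : ε * Real.sin (Real.pi * t) = 0 := by
        have := congrArg Complex.im h
        simpa [-Complex.ofReal_mul] using this
      rw [h3, mul_one_div, Real.sin_pi_div_two] at h4
      linarith
  -- Both moving points stay well above the height `-√3/2` of `ω ^ 2`; the same holds in the last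
  -- case.
  · intro h
    have := congrArg Complex.im h
    simp [lens_apply, ω_sq, ω_re, ω_im, -Complex.ofReal_mul] at this
    nlinarith
  · intro h
    have := congrArg Complex.im h
    simp [lens_apply, ω_sq, ω_re, ω_im, -Complex.ofReal_mul] at this
    nlinarith

theorem norm_twistTuple_le {ε : ℝ} (h0 : 0 ≤ ε) (h1 : ε ≤ 1 / 10) (t : I) (i : Fin 3) :
    ‖twistTuple ε t i‖ ≤ 1 := by
  fin_cases i
  · exact (norm_lens_le h0 h1 t).1
  · exact (norm_lens_le h0 h1 t).2
  · simp [twistTuple, norm_ω]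

theorem range_mul_vecThree (d a b c : ℂ) :
    range (fun i => d * ![a, b, c] i) = {d * a, d * b, d * c} := by
  rw [← range_vecThree]
  congr 1
  funext i
  fin_cases i <;> rfl

theorem range_mul_twistTuple (d : ℂ) (ε : ℝ) (t : I) :
    range (fun i => d * twistTuple ε t i) =
      {d * lens ω 1 ε t, d * lens 1 ω ε t, d * ω ^ 2} :=
  range_mul_vecThree _ _ _ _

section

variable {D : Set ℂ} {d : ℂ} {κ : UConf 3 D}

/-- The half-twist along `[d * ω, d]` in the configuration `{d, d * ω, d * ω ^ 2}`. -/
def twistPath (hd : d ≠ 0) (hD : Metric.closedBall 0 ‖d‖ ⊆ D)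
    (hκ : κ.1 = {d, d * ω, d * ω ^ 2}) {ε : ℝ} (h0 : 0 < ε) (h1 : ε ≤ 1 / 10) : Path κ κ :=
  pathOfLift (fun t i => d * twistTuple ε t i)
    (continuous_pi fun i => continuous_const.mul
      ((continuous_apply i).comp (continuous_twistTuple ε)))
    (fun t => (mul_right_injective₀ hd).comp (twistTuple_injective h0 h1 t))
    (fun t i => hD <| mem_closedBall_zero_iff.2 <| by
      rw [norm_mul]
      exact mul_le_of_le_one_right (norm_nonneg d) (norm_twistTuple_le h0.le h1 t i))
    (by rw [range_mul_twistTuple, hκ]; simp [insert_comm])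
    (by rw [range_mul_twistTuple, hκ]; simp)

theorem twistPath_apply (hd : d ≠ 0) (hD : Metric.closedBall 0 ‖d‖ ⊆ D)
    (hκ : κ.1 = {d, d * ω, d * ω ^ 2}) {ε : ℝ} (h0 : 0 < ε) (h1 : ε ≤ 1 / 10) (t : I) :
    (twistPath hd hD hκ h0 h1 t).1 = {d * lens ω 1 ε t, d * lens 1 ω ε t, d * ω ^ 2} :=
  range_mul_twistTuple d ε t

/-- Independence of the thickness is what `IsHalfTwist` demands: one braid for all sufficiently thin
lenses. -/
theorem twistPath_homotopic (hconv : Convex ℝ D) (hd : d ≠ 0)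
    (hD : Metric.closedBall 0 ‖d‖ ⊆ D) (hκ : κ.1 = {d, d * ω, d * ω ^ 2}) {ε ε' : ℝ}
    (h0 : 0 < ε) (h1 : ε ≤ 1 / 10) (h0' : 0 < ε') (h1' : ε' ≤ 1 / 10) :
    (twistPath hd hD hκ h0 h1).Homotopic (twistPath hd hD hκ h0' h1') := by
  have hcont : ∀ ε, Continuous fun (t : I) i => d * twistTuple ε t i := fun ε =>
    continuous_pi fun i => continuous_const.mul
      ((continuous_apply i).comp (continuous_twistTuple ε))
  refine homotopic_of_lifts hconv (hcont ε) (hcont ε') (fun _ => rfl) (fun _ => rfl)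
    ?_ ?_ fun s t => ?_
  · simp [twistTuple]
  · simp [twistTuple]
  · have hcomb := convex_Ioc (𝕜 := ℝ) (0 : ℝ) (1 / 10) ⟨h0, h1⟩ ⟨h0', h1'⟩
      (sub_nonneg.2 s.2.2) s.2.1 (sub_add_cancel 1 (s : ℝ))
    convert (mul_right_injective₀ hd).comp (twistTuple_injective hcomb.1 hcomb.2 t) using 1
    funext i
    have : ∀ a b : ℂ, (1 - (s : ℝ) : ℂ) * (d * a) + (s : ℝ) * (d * b) =
        d * ((1 - (s : ℝ) : ℂ) * a + (s : ℝ) * b) := fun a b => by ring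
    simp only [this, Function.comp]
    congr 1
    fin_cases i
    · exact lens_convexComb _ _ _ _ _ _
    · exact lens_convexComb _ _ _ _ _ _
    · simp only [twistTuple]
      ring_nf
      simp

theorem isHalfTwist_twistPath (hconv : Convex ℝ D) (hd : d ≠ 0)
    (hD : Metric.closedBall 0 ‖d‖ ⊆ D) (hκ : κ.1 = {d, d * ω, d * ω ^ 2}) {ε : ℝ}
    (h0 : 0 < ε) (h1 : ε ≤ 1 / 10) :
    IsHalfTwist κ (d * ω) d (PiOne.mk (twistPath hd hD hκ h0 h1)) := by
  have hs := sqrt_three_bounds.1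
  have h1ω : ω ≠ 1 := fun h => by simpa [ω_im] using congrArg Complex.im h
  have hω0 : d * ω ^ 2 ≠ d * ω := fun h => by
    have := congrArg Complex.im (mul_left_cancel₀ hd h)
    simp [ω_sq, ω_im] at this
    linarith
  have hω2 : d * ω ^ 2 ≠ d := fun h => by
    have := congrArg Complex.im (mul_left_cancel₀ hd (h.trans (mul_one d).symm))
    simp [ω_sq, ω_im] at this
  refine ⟨fun h => h1ω (mul_left_cancel₀ hd (h.trans (mul_one d).symm)), ?_, ?_⟩
  · rw [hκ]
    apply Subset.antisymm
    · rintro x ⟨hx, rfl | rfl | rfl⟩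
      · simp
      · simp
      · exfalso
        -- The points `ω` and `ω ^ 2` have the same real part, so the parameter on the segment would
        -- be `0`, and the imaginary parts then disagree.
        rw [segment_eq_image_lineMap] at hx
        obtain ⟨u, -, hu⟩ := hx
        rw [AffineMap.lineMap_apply, vsub_eq_sub, vadd_eq_add, Complex.real_smul] at hu
        have hu' : (u : ℂ) * (1 - ω) + ω = ω ^ 2 := mul_left_cancel₀ hd (by linear_combination hu)
        rw [ω_sq] at hu'
        have hre := congrArg Complex.re hu'
        have him := congrArg Complex.im hu'
        simp [ω_re] at hre
        simp [ω_im] at him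
        have hu0 : u = 0 := by linarith
        rw [hu0] at him
        linarith
    · rintro x (rfl | rfl)
      · exact ⟨left_mem_segment _ _ _, by simp⟩
      · exact ⟨right_mem_segment _ _ _, by simp⟩
  · have hev : ∀ᶠ ε' : ℝ in 𝓝[>] 0, ε' ∈ Ioc (0 : ℝ) (1 / 10) :=
      Ioc_mem_nhdsGT (by norm_num)
    filter_upwards [hev] with ε' hε'
    refine ⟨twistPath hd hD hκ hε'.1 hε'.2, fun t => ?_, ?_⟩
    · have hdiff : κ.1 \ {d * ω, d} = {d * ω ^ 2} := by
        rw [hκ]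
        ext x
        simp only [mem_sdiff, mem_insert_iff, mem_singleton_iff]
        constructor
        · tauto
        · rintro rfl
          tauto
      rw [twistPath_apply, hdiff, ← lens_mul, ← lens_mul, mul_one, singleton_union,
        insert_comm (d * ω ^ 2), pair_comm (d * ω ^ 2), lens_apply, lens_apply]
      congr 2
      ring_nf
    · exact congrArg (fun x => MulOpposite.op (FundamentalGroup.fromPath x))
        (Path.Homotopic.Quotient.eq.2 (twistPath_homotopic hconv hd hD hκ h0 h1 hε'.1 hε'.2))

end

/-! ### The product of the two half-twists is a rotation -/

/-- Two nonzero complex numbers in a common closed half plane are not opposite if one of them is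
in the open half plane. -/
theorem convexComb_ne_zero {a b : ℂ} (k : ℂ) (ha : a ≠ 0) (hb : b ≠ 0) (hka : 0 ≤ (k * a).re)
    (hkb : 0 ≤ (k * b).re) (h : 0 < (k * a).re ∨ 0 < (k * b).re ∨ a = b) (s : I) :
    (1 - (s : ℝ) : ℂ) * a + (s : ℝ) * b ≠ 0 := by
  intro h0
  have hs0 := s.2.1
  have hs1 := s.2.2
  have hre : (1 - (s : ℝ)) * (k * a).re + s * (k * b).re = 0 := by
    have h1 : (((1 - (s : ℝ) : ℝ) : ℂ) * (k * a) + ((s : ℝ) : ℂ) * (k * b)).re = 0 := by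
      rw [show ((1 - (s : ℝ) : ℝ) : ℂ) * (k * a) + ((s : ℝ) : ℂ) * (k * b) =
        k * ((1 - (s : ℝ) : ℂ) * a + (s : ℝ) * b) by push_cast; ring, h0, mul_zero,
        Complex.zero_re]
    simpa only [Complex.add_re, Complex.re_ofReal_mul] using h1
  rcases h with h | h | rfl
  · rcases hs1.lt_or_eq with h1 | h1
    · nlinarith [mul_pos (sub_pos.2 h1) h, mul_nonneg hs0 hkb]
    · rw [h1] at h0
      simp [hb] at h0
  · rcases hs0.lt_or_eq with h1 | h1
    · nlinarith [mul_pos h1 h, mul_nonneg (sub_nonneg.2 hs1) hka]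
    · rw [← h1] at h0
      simp [ha] at h0
  · exact ha (by linear_combination h0)

/-- Interpolation commutes with differences, so collisions can be excluded for each pair separately.
-/
theorem convexComb_injective {a b c a' b' c' : ℂ} {s : I}
    (h1 : (1 - (s : ℝ) : ℂ) * (a - b) + (s : ℝ) * (a' - b') ≠ 0)
    (h2 : (1 - (s : ℝ) : ℂ) * (b - c) + (s : ℝ) * (b' - c') ≠ 0)
    (h3 : (1 - (s : ℝ) : ℂ) * (c - a) + (s : ℝ) * (c' - a') ≠ 0) :
    Function.Injective fun i =>
      (1 - (s : ℝ) : ℂ) * ![a, b, c] i + (s : ℝ) * ![a', b', c'] i := by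
  have h := injective_vecThree (a := (1 - (s : ℝ) : ℂ) * a + (s : ℝ) * a')
    (b := (1 - (s : ℝ) : ℂ) * b + (s : ℝ) * b') (c := (1 - (s : ℝ) : ℂ) * c + (s : ℝ) * c')
    (fun h => h1 (by linear_combination h)) (fun h => h2 (by linear_combination h))
    (fun h => h3 (by linear_combination h))
  convert h using 1
  funext i
  fin_cases i <;> rfl

theorem lens_ω_sq_ω (ε : ℝ) (t : I) : lens (ω ^ 2) ω ε t = ω * lens ω 1 ε t := by
  rw [← lens_mul, sq, mul_one]

theorem lens_ω_ω_sq (ε : ℝ) (t : I) : lens ω (ω ^ 2) ε t = ω * lens 1 ω ε t := by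
  rw [← lens_mul, sq, mul_one]

theorem ω_ne_zero : ω ≠ 0 := ω_isPrimitiveRoot.ne_zero (by norm_num)

theorem rotation_sub_ne_zero {E : ℂ} (hE : E ≠ 0) :
    E - E * ω ≠ 0 ∧ E * ω - E * ω ^ 2 ≠ 0 ∧ E * ω ^ 2 - E ≠ 0 := by
  have h := cube_root_injective hE
  refine ⟨fun h' => ?_, fun h' => ?_, fun h' => ?_⟩
  · simpa using @h 0 1 (by simpa using sub_eq_zero.1 h')
  · simpa using @h 1 2 (by simpa using sub_eq_zero.1 h')
  · simpa using @h 2 0 (by simpa using sub_eq_zero.1 h')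

theorem twistTuple_sub_ne_zero {ε : ℝ} (h0 : 0 < ε) (h1 : ε ≤ 1 / 10) (u : I) :
    lens ω 1 ε u - lens 1 ω ε u ≠ 0 ∧ lens 1 ω ε u - ω ^ 2 ≠ 0 ∧ ω ^ 2 - lens ω 1 ε u ≠ 0 := by
  have h := twistTuple_injective h0 h1 u
  refine ⟨fun h' => ?_, fun h' => ?_, fun h' => ?_⟩
  · simpa using @h 0 1 (sub_eq_zero.1 h')
  · simpa using @h 1 2 (sub_eq_zero.1 h')
  · simpa using @h 2 0 (sub_eq_zero.1 h')

/-- The hypotheses on `E` place its argument in `[0, π/3]`, the first half of the rotation. The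
twisted side `[ω ^ 2, ω]` is vertical, so the signs of real parts decide: `k = 1` for the first
pair, `k = -1` for the other two. Both difference vectors of the twisting pair can lie on the
boundary line only at the start, where they coincide. -/
theorem first_twist_injective {ε : ℝ} (h0 : 0 < ε) (h1 : ε ≤ 1 / 10) (u s : I) {E : ℂ}
    (hE : E ≠ 0) (hE1 : 0 ≤ E.im) (hE2 : E.im ≤ √3 * E.re) (hE3 : 0 < E.im ∨ u = 0 ∧ E = 1) :
    Function.Injective fun i =>
      (1 - (s : ℝ) : ℂ) * ![1, lens ω (ω ^ 2) ε u, lens (ω ^ 2) ω ε u] i +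
        (s : ℝ) * ![E, E * ω, E * ω ^ 2] i := by
  obtain ⟨hs, hs2, hs3, hs4⟩ := sqrt_three_bounds
  have hc := Real.sin_le_one (Real.pi * u)
  have hη0 : 0 ≤ ε * Real.sin (Real.pi * u) := mul_nonneg h0.le (sin_pi_nonneg u)
  have hη2 : ε * Real.sin (Real.pi * u) ≤ 1 / 10 := by nlinarith
  obtain ⟨hn1, hn2, hn3⟩ := twistTuple_sub_ne_zero h0 h1 u
  obtain ⟨hb1, hb2, hb3⟩ := rotation_sub_ne_zero hE
  have hEre : 0 ≤ E.re := by
    by_contra! h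
    nlinarith
  refine convexComb_injective (convexComb_ne_zero 1 ?_ hb1 ?_ ?_ (Or.inl ?_) s)
    (convexComb_ne_zero (-1) ?_ hb2 ?_ ?_ ?_ s) (convexComb_ne_zero (-1) ?_ hb3 ?_ ?_ (Or.inl ?_) s)
  · rw [lens_ω_ω_sq, show 1 - ω * lens 1 ω ε u = -ω * (lens 1 ω ε u - ω ^ 2) by
      linear_combination -ω_pow_three]
    exact mul_ne_zero (neg_ne_zero.2 ω_ne_zero) hn2
  · simp [lens_apply, ω_sq, ω_re, ω_im, -Complex.ofReal_mul]
    nlinarith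
  · simp [ω_re, ω_im]
    nlinarith
  · simp [lens_apply, ω_sq, ω_re, ω_im, -Complex.ofReal_mul]
    nlinarith
  · rw [lens_ω_ω_sq, lens_ω_sq_ω, ← mul_sub, ← neg_sub]
    exact mul_ne_zero ω_ne_zero (neg_ne_zero.2 hn1)
  · simp [lens_apply, ω_sq, ω_re, ω_im, -Complex.ofReal_mul]
    nlinarith
  · simp [ω_sq, ω_re, ω_im]
    nlinarith
  · rcases hE3 with h | ⟨rfl, rfl⟩
    · right; left
      simp [ω_sq, ω_re, ω_im]
      nlinarith
    · right; right
      simp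
  · rw [lens_ω_sq_ω, show ω * lens ω 1 ε u - 1 = -ω * (ω ^ 2 - lens ω 1 ε u) by
      linear_combination ω_pow_three]
    exact mul_ne_zero (neg_ne_zero.2 ω_ne_zero) hn3
  · simp [lens_apply, ω_sq, ω_re, ω_im, -Complex.ofReal_mul]
    nlinarith
  · simp [ω_sq, ω_re, ω_im]
    nlinarith
  · simp [lens_apply, ω_sq, ω_re, ω_im, -Complex.ofReal_mul]
    nlinarith

/-- Here the argument of `E` lies in `[π/3, 2π/3]`. Multiplication by `ω` carries the twisted side
`[ω, 1]` to the vertical side `[ω ^ 2, ω]`, whence `k = ±ω`. The degenerate position of the twisting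
pair now occurs at the end, `u = 1` and `E = ω`. -/
theorem second_twist_injective {ε : ℝ} (h0 : 0 < ε) (h1 : ε ≤ 1 / 10) (u s : I) {E : ℂ}
    (hE : E ≠ 0) (hE1 : 0 ≤ E.im) (hE2 : √3 * E.re ≤ E.im) (hE4 : 0 ≤ √3 * E.re + E.im)
    (hE3 : 0 < √3 * E.re + E.im ∨ u = 1 ∧ E = ω) :
    Function.Injective fun i =>
      (1 - (s : ℝ) : ℂ) * ![lens 1 ω ε u, ω ^ 2, lens ω 1 ε u] i +
        (s : ℝ) * ![E, E * ω, E * ω ^ 2] i := by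
  obtain ⟨hs, hs2, hs3, hs4⟩ := sqrt_three_bounds
  have hc := Real.sin_le_one (Real.pi * u)
  have hη0 : 0 ≤ ε * Real.sin (Real.pi * u) := mul_nonneg h0.le (sin_pi_nonneg u)
  have hη2 : ε * Real.sin (Real.pi * u) ≤ 1 / 10 := by nlinarith
  obtain ⟨hn1, hn2, hn3⟩ := twistTuple_sub_ne_zero h0 h1 u
  obtain ⟨hb1, hb2, hb3⟩ := rotation_sub_ne_zero hE
  have hA : ω * (lens 1 ω ε u - ω ^ 2) = ω - 1 + (ω ^ 2 - ω) *
      ((u : ℝ) - Complex.I * (ε * Real.sin (Real.pi * u) : ℝ)) := by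
    rw [lens_apply]
    linear_combination -ω_pow_three
  have hB : ω * (ω ^ 2 - lens ω 1 ε u) = 1 - ω ^ 2 - (ω - ω ^ 2) *
      ((u : ℝ) - Complex.I * (ε * Real.sin (Real.pi * u) : ℝ)) := by
    rw [lens_apply]
    linear_combination ω_pow_three
  have hC : ω * (lens ω 1 ε u - lens 1 ω ε u) = (ω ^ 2 - ω) * (1 -
      2 * ((u : ℝ) - Complex.I * (ε * Real.sin (Real.pi * u) : ℝ))) := by
    rw [lens_apply, lens_apply]
    ring
  have hA' : ω * (E - E * ω) = E * (ω - ω ^ 2) := by ring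
  have hB' : ω * (E * ω - E * ω ^ 2) = E * (ω ^ 2 - 1) := by
    linear_combination -E * ω_pow_three
  have hC' : ω * (E * ω ^ 2 - E) = E * (1 - ω) := by
    linear_combination E * ω_pow_three
  refine convexComb_injective (convexComb_ne_zero (-ω) hn2 hb1 ?_ ?_ (Or.inl ?_) s)
    (convexComb_ne_zero ω hn3 hb2 ?_ ?_ (Or.inl ?_) s)
    (convexComb_ne_zero ω hn1 hb3 ?_ ?_ ?_ s)
  · rw [neg_mul, hA]
    simp [ω_sq, ω_re, ω_im, -Complex.ofReal_mul]
    nlinarith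
  · rw [neg_mul, hA']
    simp [ω_sq, ω_re, ω_im]
    nlinarith
  · rw [neg_mul, hA]
    simp [ω_sq, ω_re, ω_im, -Complex.ofReal_mul]
    nlinarith
  · rw [hB]
    simp [ω_sq, ω_re, ω_im, -Complex.ofReal_mul]
    nlinarith
  · rw [hB']
    simp [ω_sq, ω_re, ω_im]
    nlinarith
  · rw [hB]
    simp [ω_sq, ω_re, ω_im, -Complex.ofReal_mul]
    nlinarith
  · rw [hC]
    simp [ω_sq, ω_re, ω_im, -Complex.ofReal_mul]
    nlinarith
  · rw [hC']
    simp [ω_re, ω_im]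
    nlinarith
  · rcases hE3 with h | ⟨rfl, rfl⟩
    · right; left
      rw [hC']
      simp [ω_re, ω_im]
      nlinarith
    · right; right
      simp only [Path.target]
      linear_combination -ω_pow_three

/-- The unit complex number `exp(2πit/3)`. -/
def rot (t : ℝ) : ℂ := Complex.exp ((2 * Real.pi / 3 * t : ℝ) * Complex.I)

theorem rot_re (t : ℝ) : (rot t).re = Real.cos (2 * Real.pi / 3 * t) :=
  Complex.exp_ofReal_mul_I_re _

theorem rot_im (t : ℝ) : (rot t).im = Real.sin (2 * Real.pi / 3 * t) :=
  Complex.exp_ofReal_mul_I_im _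

theorem rot_ne_zero (t : ℝ) : rot t ≠ 0 := Complex.exp_ne_zero _

theorem norm_rot (t : ℝ) : ‖rot t‖ = 1 := Complex.norm_exp_ofReal_mul_I _

theorem continuous_rot : Continuous rot := by
  unfold rot
  fun_prop

theorem rot_zero : rot 0 = 1 := by simp [rot]

theorem rot_one : rot 1 = ω := by
  rw [rot, ω]
  congr 1
  push_cast
  ring

theorem rot_pow_three (t : ℝ) : rot t ^ 3 = Complex.exp (2 * Real.pi * Complex.I * (t : ℂ)) := by
  rw [rot, ← Complex.exp_nat_mul]
  congr 1
  push_cast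
  ring

theorem rot_first_half {t : ℝ} (h0 : 0 ≤ t) (h1 : t ≤ 1 / 2) :
    0 ≤ (rot t).im ∧ (rot t).im ≤ √3 * (rot t).re ∧ (0 < (rot t).im ∨ t = 0) := by
  have hp := Real.pi_pos
  rw [rot_re, rot_im]
  refine ⟨Real.sin_nonneg_of_nonneg_of_le_pi (by positivity) (by nlinarith), ?_, ?_⟩
  -- Up to the factor 2 the inequality is `sin(π/3 - θ) ≥ 0`, where `θ` is the angle of `rot t`.
  · have h := Real.sin_nonneg_of_nonneg_of_le_pi (x := Real.pi / 3 - 2 * Real.pi / 3 * t)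
      (by nlinarith) (by nlinarith)
    rw [Real.sin_sub, Real.sin_pi_div_three, Real.cos_pi_div_three] at h
    linarith
  · rcases h0.eq_or_lt with h | h
    · exact Or.inr h.symm
    · exact Or.inl (Real.sin_pos_of_pos_of_lt_pi (by positivity) (by nlinarith))

theorem rot_second_half {t : ℝ} (h0 : 1 / 2 ≤ t) (h1 : t ≤ 1) :
    0 ≤ (rot t).im ∧ √3 * (rot t).re ≤ (rot t).im ∧ 0 ≤ √3 * (rot t).re + (rot t).im ∧
      (0 < √3 * (rot t).re + (rot t).im ∨ t = 1) := by
  have hp := Real.pi_pos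
  have hsin : √3 * (rot t).re + (rot t).im = 2 * Real.sin (2 * Real.pi / 3 * t + Real.pi / 3) := by
    rw [Real.sin_add, Real.sin_pi_div_three, Real.cos_pi_div_three, rot_re, rot_im]
    ring
  rw [hsin, rot_re, rot_im]
  refine ⟨Real.sin_nonneg_of_nonneg_of_le_pi (by positivity) (by nlinarith), ?_, ?_, ?_⟩
  · have h := Real.sin_nonneg_of_nonneg_of_le_pi (x := 2 * Real.pi / 3 * t - Real.pi / 3)
      (by nlinarith) (by nlinarith)
    rw [Real.sin_sub, Real.sin_pi_div_three, Real.cos_pi_div_three] at h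
    linarith
  · have h := Real.sin_nonneg_of_nonneg_of_le_pi (x := 2 * Real.pi / 3 * t + Real.pi / 3)
      (by positivity) (by nlinarith)
    linarith
  · rcases h1.eq_or_lt with h | h
    · exact Or.inr h
    · have := Real.sin_pos_of_pos_of_lt_pi (x := 2 * Real.pi / 3 * t + Real.pi / 3)
        (by positivity) (by nlinarith)
      exact Or.inl (by linarith)

section

variable {D : Set ℂ} {c : ℂ} {κ : UConf 3 D}

/-- The rotation of the configuration `{c, c * ω, c * ω ^ 2}` by the angle `2π/3`. -/
def rotationPath (hc : c ≠ 0) (hD : Metric.closedBall 0 ‖c‖ ⊆ D)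
    (hκ : κ.1 = {c, c * ω, c * ω ^ 2}) : Path κ κ :=
  pathOfLift (fun t i => c * (rot t * ω ^ (i : ℕ)))
    (continuous_pi fun i => continuous_const.mul
      ((continuous_rot.comp continuous_subtype_val).mul continuous_const))
    (fun t => (mul_right_injective₀ hc).comp (cube_root_injective (rot_ne_zero t)))
    (fun t i => hD <| mem_closedBall_zero_iff.2 <| by simp [norm_rot, norm_ω])
    (by
      rw [hκ, ← range_vecThree]
      congr 1
      funext i
      fin_cases i <;> simp [rot_zero])
    (by
      have h : (fun i : Fin 3 => c * (rot (1 : I) * ω ^ (i : ℕ))) = ![c * ω, c * ω ^ 2, c] := by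
        funext i
        fin_cases i
        · simp [rot_one]
        · simp [rot_one, sq]
        · simp [rot_one, ← pow_succ', ω_pow_three]
      rw [h, hκ, range_vecThree]
      ext x
      simp only [mem_insert_iff, mem_singleton_iff]
      tauto)

theorem rotationPath_apply (hc : c ≠ 0) (hD : Metric.closedBall 0 ‖c‖ ⊆ D)
    (hκ : κ.1 = {c, c * ω, c * ω ^ 2}) (t : I) :
    (rotationPath hc hD hκ t).1 = range fun i : Fin 3 => c * rot t * ω ^ (i : ℕ) := by
  simp only [mul_assoc]
  rfl

/-- The motion of the three cube roots of unity that consists of the half-twist along `[ω ^ 2, ω]`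
followed by the half-twist along `[ω, 1]`. -/
def twoTwistsTuple (ε : ℝ) (t : I) : Fin 3 → ℂ :=
  ![((Path.refl 1).trans (lens 1 ω ε)) t, ((lens ω (ω ^ 2) ε).trans (Path.refl (ω ^ 2))) t,
    ((lens (ω ^ 2) ω ε).trans (lens ω 1 ε)) t]

theorem continuous_twoTwistsTuple (ε : ℝ) : Continuous (twoTwistsTuple ε) := by
  refine continuous_pi fun i => ?_
  fin_cases i
  · exact ((Path.refl 1).trans (lens 1 ω ε)).continuous
  · exact ((lens ω (ω ^ 2) ε).trans (Path.refl (ω ^ 2))).continuous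
  · exact ((lens (ω ^ 2) ω ε).trans (lens ω 1 ε)).continuous

/-- The labelling in `twoTwistsTuple` makes the lifts match: like the rotation, the two twists
together send `1` to `ω`, `ω` to `ω ^ 2` and `ω ^ 2` to `1`. The first twist, taken with `d = c *
ω`, fixes `c * ω * ω ^ 2 = c`. -/
theorem twist_trans_twist_homotopic (hconv : Convex ℝ D) (hc : c ≠ 0)
    (hD : Metric.closedBall 0 ‖c‖ ⊆ D) (hκ : κ.1 = {c, c * ω, c * ω ^ 2})
    (hcω : c * ω ≠ 0) (hD' : Metric.closedBall 0 ‖c * ω‖ ⊆ D)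
    (hκ' : κ.1 = {c * ω, c * ω * ω, c * ω * ω ^ 2}) {ε : ℝ} (h0 : 0 < ε) (h1 : ε ≤ 1 / 10) :
    ((twistPath hcω hD' hκ' h0 h1).trans (twistPath hc hD hκ h0 h1)).Homotopic
      (rotationPath hc hD hκ) := by
  have hG : ∀ t, ![rot t, rot t * ω, rot t * ω ^ 2] = fun i : Fin 3 => rot t * ω ^ (i : ℕ) := by
    intro t
    funext i
    fin_cases i <;> simp
  refine homotopic_of_lifts (f := fun t i => c * twoTwistsTuple ε t i)
    (g := fun t i => c * ![rot t, rot t * ω, rot t * ω ^ 2] i) hconv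
    (continuous_pi fun i => continuous_const.mul
      ((continuous_apply i).comp (continuous_twoTwistsTuple ε))) ?_ (fun t => ?_) (fun t => ?_)
    ?_ ?_ fun s t => ?_
  · simp only [hG]
    exact continuous_pi fun i => continuous_const.mul
      ((continuous_rot.comp continuous_subtype_val).mul continuous_const)
  · simp only [twoTwistsTuple, range_mul_vecThree, Path.trans_apply]
    split_ifs with h
    · rw [twistPath_apply, lens_ω_sq_ω, lens_ω_ω_sq, Path.refl_apply, mul_assoc c ω (ω ^ 2),
        ← pow_succ', ω_pow_three, mul_assoc, mul_assoc]
      ext x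
      simp only [mem_insert_iff, mem_singleton_iff]
      tauto
    · rw [twistPath_apply, Path.refl_apply]
      ext x
      simp only [mem_insert_iff, mem_singleton_iff]
      tauto
  · rw [rotationPath_apply]
    simp only [hG, mul_assoc]
  · funext i
    fin_cases i <;> simp [twoTwistsTuple, rot_zero]
  · funext i
    fin_cases i
    · simp [twoTwistsTuple, rot_one]
    · simp [twoTwistsTuple, rot_one, sq]
    · simp [twoTwistsTuple, rot_one, ← pow_succ', ω_pow_three]
  · have hcomp : ∀ i, (1 - (s : ℝ) : ℂ) * (c * twoTwistsTuple ε t i) +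
        (s : ℝ) * (c * ![rot t, rot t * ω, rot t * ω ^ 2] i) =
        c * ((1 - (s : ℝ) : ℂ) * twoTwistsTuple ε t i +
          (s : ℝ) * ![rot t, rot t * ω, rot t * ω ^ 2] i) := fun i => by ring
    simp only [hcomp]
    refine (mul_right_injective₀ hc).comp (f := fun i => _) ?_
    simp only [twoTwistsTuple, Path.trans_apply]
    split_ifs with h
    · obtain ⟨hi, hr, h3⟩ := rot_first_half t.2.1 h
      refine first_twist_injective h0 h1 _ s (rot_ne_zero t) hi hr (h3.imp_right fun h => ?_)
      exact ⟨Subtype.ext (by simp [h]), by rw [h, rot_zero]⟩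
    · obtain ⟨hi, hr, h2, h3⟩ := rot_second_half (not_le.1 h).le t.2.2
      refine second_twist_injective h0 h1 _ s (rot_ne_zero t) hi hr h2 (h3.imp_right fun h => ?_)
      exact ⟨Subtype.ext (by simp [h]; norm_num), by rw [h, rot_one]⟩

end

/-! ### The fundamental group of a punctured disc -/

section

variable {r : ℝ}

theorem mem_punctured {x : ℂ} :
    x ∈ Metric.closedBall (0 : ℂ) r \ branchLocus cuspCurve 3 ↔ ‖x‖ ≤ r ∧ x ≠ 0 := by
  rw [branchLocus_cusp, mem_sdiff, mem_closedBall_zero_iff, mem_singleton_iff]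

/-- The half plane that the exponential map sends to the punctured disc of radius `r`. -/
def logPlane (r : ℝ) : Set ℂ := {w | w.re ≤ Real.log r}

theorem mem_logPlane (hr : 0 < r) {w : ℂ} : w ∈ logPlane r ↔ ‖Complex.exp w‖ ≤ r := by
  rw [Complex.norm_exp, logPlane, mem_ofPred_eq, Real.le_log_iff_exp_le hr]

theorem convex_logPlane (r : ℝ) : Convex ℝ (logPlane r) :=
  convex_halfSpace_re_le _

/-- The exponential map from a half plane to a punctured disc. -/
def expPlane (hr : 0 < r) (w : logPlane r) :
    ↥(Metric.closedBall (0 : ℂ) r \ branchLocus cuspCurve 3) :=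
  ⟨Complex.exp w, mem_punctured.2 ⟨(mem_logPlane hr).1 w.2, Complex.exp_ne_zero _⟩⟩

theorem continuous_expPlane (hr : 0 < r) : Continuous (expPlane hr) := by
  unfold expPlane
  fun_prop

variable {M : ↥(Metric.closedBall (0 : ℂ) r \ branchLocus cuspCurve 3)}

/-- The loop below a path in the half plane. -/
def expLoop (hr : 0 < r) {v w : logPlane r} (P : Path v w) (hv : expPlane hr v = M)
    (hw : expPlane hr w = M) : Path M M :=
  (P.map (continuous_expPlane hr)).cast hv.symm hw.symm

theorem expLoop_apply (hr : 0 < r) {v w : logPlane r} (P : Path v w) (hv : expPlane hr v = M)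
    (hw : expPlane hr w = M) (t : I) : expLoop hr P hv hw t = expPlane hr (P t) := rfl

theorem mk_expLoop_mul (hr : 0 < r) {u v w : logPlane r} (P : Path u v) (Q : Path v w)
    (hu : expPlane hr u = M) (hv : expPlane hr v = M) (hw : expPlane hr w = M) :
    PiOne.mk (expLoop hr P hu hv) * PiOne.mk (expLoop hr Q hv hw) =
      PiOne.mk (expLoop hr (P.trans Q) hu hw) := by
  rw [PiOne.mk_mul_mk]
  congr 1
  refine Path.ext (funext fun t => ?_)
  simp only [expLoop_apply, Path.trans_apply]
  split_ifs <;> rfl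

theorem simplyConnectedSpace_logPlane (v : logPlane r) : SimplyConnectedSpace (logPlane r) :=
  have := (convex_logPlane r).contractibleSpace ⟨v, v.2⟩
  inferInstance

/-- The half plane is simply connected, so the class of the loop depends only on the end points of
its lift. -/
theorem mk_expLoop_eq (hr : 0 < r) {v w : logPlane r} (P Q : Path v w) (hv : expPlane hr v = M)
    (hw : expPlane hr w = M) :
    PiOne.mk (expLoop hr P hv hw) = PiOne.mk (expLoop hr Q hv hw) := by
  have := simplyConnectedSpace_logPlane v
  subst hv
  obtain ⟨H⟩ := SimplyConnectedSpace.paths_homotopic P Q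
  refine congrArg (fun x => MulOpposite.op (FundamentalGroup.fromPath x))
    (Path.Homotopic.Quotient.eq.2 ⟨?_⟩)
  exact (H.map ⟨_, continuous_expPlane hr⟩).pathCast rfl hw.symm

/-- The translate of `w` by `2πin`. -/
def translate (w : logPlane r) (n : ℤ) : logPlane r :=
  ⟨w + n * (2 * Real.pi * Complex.I), by
    have := w.2
    simpa [logPlane] using this⟩

theorem expPlane_translate (hr : 0 < r) (w : logPlane r) (n : ℤ) :
    expPlane hr (translate w n) = expPlane hr w :=
  Subtype.ext (Complex.exp_eq_exp_iff_exists_int.2 ⟨n, rfl⟩)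

/-- The segment from a translate of `w` to the next one. -/
def translateStep (w : logPlane r) (n : ℤ) : Path (translate w n) (translate w (n + 1)) where
  toFun t := ⟨w + (n + (t : ℝ)) * (2 * Real.pi * Complex.I), by
    have := w.2
    simpa [logPlane] using this⟩
  continuous_toFun := by fun_prop
  source' := Subtype.ext (by simp [translate])
  target' := Subtype.ext (by simp [translate])

theorem expLoop_translateStep (hr : 0 < r) (w : logPlane r) (n : ℤ) (hw : expPlane hr w = M) :
    expLoop hr (translateStep w n) ((expPlane_translate hr w n).trans hw)
      ((expPlane_translate hr w (n + 1)).trans hw) = cuspLoop M := by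
  refine Path.ext (funext fun t => Subtype.ext ?_)
  change Complex.exp (w + (n + (t : ℝ)) * (2 * Real.pi * Complex.I)) =
    Complex.exp (2 * Real.pi * Complex.I * ((t : ℝ) : ℂ)) * M
  rw [← hw, expPlane, ← Complex.exp_add, Complex.exp_eq_exp_iff_exists_int]
  exact ⟨n, by ring⟩

/-- Each translation by `2πi` contributes one factor, as `translateStep` lies over `cuspLoop M`. -/
theorem mk_expLoop (hr : 0 < r) (w : logPlane r) (n : ℤ) (hw : expPlane hr w = M) :
    ∀ P : Path w (translate w n),
      PiOne.mk (expLoop hr P hw ((expPlane_translate hr w n).trans hw)) =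
        PiOne.mk (cuspLoop M) ^ n := by
  have := simplyConnectedSpace_logPlane w
  have step : ∀ n : ℤ, ∀ P : Path w (translate w n), ∀ Q : Path w (translate w (n + 1)),
      PiOne.mk (expLoop hr Q hw ((expPlane_translate hr w (n + 1)).trans hw)) =
        PiOne.mk (expLoop hr P hw ((expPlane_translate hr w n).trans hw)) *
          PiOne.mk (cuspLoop M) := by
    intro n P Q
    rw [← expLoop_translateStep hr w n hw, mk_expLoop_mul]
    exact mk_expLoop_eq hr _ _ _ _
  induction n with
  | zero =>
    intro P
    have h0 : translate w 0 = w := Subtype.ext (by simp [translate])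
    have h := mk_expLoop_eq hr P ((Path.refl w).cast rfl h0) hw
      ((expPlane_translate hr w 0).trans hw)
    rw [h, zpow_zero]
    subst hw
    rfl
  | succ n ih =>
    intro P
    rw [step n (PathConnectedSpace.somePath _ _) P, ih, zpow_add_one]
  | pred n ih =>
    intro P
    -- One step forward from `-n - 1` leads back to `-n`, where the induction hypothesis applies.
    have h := ih (((P.trans (translateStep w (-n - 1)))).cast rfl (by rw [sub_add_cancel]))
    rw [zpow_sub_one, ← h, eq_mul_inv_iff_mul_eq, ← expLoop_translateStep hr w (-n - 1) hw,
      mk_expLoop_mul]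
    rfl

theorem exists_lift_loop (hr : 0 < r) (w : logPlane r) (hw : expPlane hr w = M) (γ : Path M M) :
    ∃ (n : ℤ) (P : Path w (translate w n)),
      expLoop hr P hw ((expPlane_translate hr w n).trans hw) = γ := by
  let δ : C(I, {z : ℂ // z ≠ 0}) :=
    ⟨fun t => ⟨γ t, ne_zero_of_mem (γ t)⟩, by fun_prop⟩
  have hδ0 : δ 0 = ⟨_, Complex.exp_ne_zero w⟩ :=
    Subtype.ext ((congrArg Subtype.val γ.source).trans (congrArg Subtype.val hw.symm))
  obtain ⟨Γ, hΓ, hΓ0⟩ := Complex.isCoveringMap_exp.exists_path_lifts δ w hδ0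
  have hexp : ∀ t, Complex.exp (Γ t) = γ t := fun t => congrArg Subtype.val (congrFun hΓ t)
  -- The lift is taken for the covering of the whole punctured plane; the bound `‖γ t‖ ≤ r` confines
  -- it to the half plane.
  have hmem : ∀ t, Γ t ∈ logPlane r := fun t => by
    rw [mem_logPlane hr, hexp]
    exact (mem_punctured.1 (γ t).2).1
  obtain ⟨n, hn⟩ := Complex.exp_eq_exp_iff_exists_int.1
    (((hexp 1).trans (congrArg Subtype.val γ.target)).trans (congrArg Subtype.val hw.symm))
  exact ⟨n, ⟨⟨fun t => ⟨Γ t, hmem t⟩, by fun_prop⟩, Subtype.ext hΓ0, Subtype.ext hn⟩,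
    Path.ext (funext fun t => Subtype.ext (hexp t))⟩

theorem zpowers_mk_cuspLoop (hr : 0 < r) :
    Subgroup.zpowers (PiOne.mk (cuspLoop M)) = ⊤ := by
  have hexp : Complex.exp (Complex.log M) = M := Complex.exp_log (ne_zero_of_mem M)
  let w : logPlane r := ⟨Complex.log M, by
    rw [mem_logPlane hr, hexp]
    exact (mem_punctured.1 M.2).1⟩
  have hw : expPlane hr w = M := Subtype.ext hexp
  rw [eq_top_iff]
  intro x _
  obtain ⟨x⟩ := x
  induction x using Path.Homotopic.Quotient.ind with
  | mk γ =>
    obtain ⟨n, P, rfl⟩ := exists_lift_loop hr w hw γ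
    exact ⟨n, (mk_expLoop hr w n hw P).symm⟩

end

/-! ### The braid monodromy of the cusp -/

section

variable {r : ℝ} {D : Set ℂ} {M : ↥(Metric.closedBall (0 : ℂ) r \ branchLocus cuspCurve 3)}
  {c : ℂ}

/-- A point `y` with `‖y‖ ≤ ‖c‖` lies in the fibre over a square root `x` of `y ^ 3`, and `‖x‖² =
‖y‖³ ≤ ‖c‖³ = r²`. -/
theorem closedBall_subset_of_cusp
    (hD : ∀ p ∈ cuspCurve, p.1 ∈ Metric.closedBall (0 : ℂ) r → p.2 ∈ D)
    (hM : ‖(M : ℂ)‖ = r) (hc : c ^ 3 = (M : ℂ) ^ 2) :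
    Metric.closedBall 0 ‖c‖ ⊆ D := by
  intro y hy
  rw [mem_closedBall_zero_iff] at hy
  obtain ⟨x, hx⟩ := IsAlgClosed.exists_pow_nat_eq (y ^ 3) (n := 2) (by norm_num)
  refine hD (x, y) (sub_eq_zero.2 hx.symm) (mem_closedBall_zero_iff.2 ?_)
  have h1 : ‖x‖ ^ 2 ≤ ‖(M : ℂ)‖ ^ 2 := by
    rw [← norm_pow, ← norm_pow, hx, ← hc, norm_pow, norm_pow]
    gcongr
  exact ((sq_le_sq₀ (norm_nonneg _) (norm_nonneg _)).1 h1).trans hM.le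

/-- The paths are equal, not merely homotopic: `c * rot u` is a cube root of the squared base point
for `u = 2t`, and for `u = 2t - 1` in the second half. -/
theorem cuspLoop_map
    (hD : ∀ p ∈ cuspCurve, p.1 ∈ Metric.closedBall (0 : ℂ) r → p.2 ∈ D)
    (hc0 : c ≠ 0) (hball : Metric.closedBall 0 ‖c‖ ⊆ D)
    (hc : c ^ 3 = (M : ℂ) ^ 2)
    (hκ : (fiberConf cuspCurve 3 _ D fiber_cusp_encard_le hD M).1 = {c, c * ω, c * ω ^ 2}) :
    (cuspLoop M).map (continuous_fiberConf_cusp _ _ hD) =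
      (rotationPath hc0 hball hκ).trans (rotationPath hc0 hball hκ) := by
  refine Path.ext (funext fun t => Subtype.ext ?_)
  have hM0 := ne_zero_of_mem M
  have hfib : ∀ u : ℝ, Complex.exp (2 * Real.pi * Complex.I * (u : ℂ)) =
      Complex.exp (2 * Real.pi * Complex.I * ((t : ℝ) : ℂ)) ^ 2 →
      fiber cuspCurve (Complex.exp (2 * Real.pi * Complex.I * ((t : ℝ) : ℂ)) * M) =
        range fun i : Fin 3 => c * rot u * ω ^ (i : ℕ) := by
    intro u hu
    refine fiber_cusp (mul_ne_zero (Complex.exp_ne_zero _) hM0) ?_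
    rw [mul_pow, mul_pow, hc, rot_pow_three, ← hu]
    ring
  change fiber cuspCurve (Complex.exp (2 * Real.pi * Complex.I * ((t : ℝ) : ℂ)) * M) = _
  rw [Path.trans_apply]
  split_ifs with h
  · rw [rotationPath_apply]
    refine hfib _ ?_
    rw [← Complex.exp_nat_mul]
    congr 1
    push_cast
    ring
  · rw [rotationPath_apply]
    refine hfib _ ?_
    rw [← Complex.exp_nat_mul, Complex.exp_eq_exp_iff_exists_int]
    -- The shift from `2t` to `2t - 1` changes the exponent by one period.
    refine ⟨-1, ?_⟩
    push_cast
    ring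

end

end

end BraidMonodromy

open BraidMonodromy in
theorem mainTheorem6 (r : ℝ) (hr : 0 < r) (z : ℂ) (R : ℝ)
    (hD : ∀ p ∈ BraidMonodromy.cuspCurve,
      p.1 ∈ Metric.closedBall (0 : ℂ) r → p.2 ∈ Metric.closedBall z R)
    (M : ↥(Metric.closedBall (0 : ℂ) r \ BraidMonodromy.branchLocus BraidMonodromy.cuspCurve 3))
    (hM : (M : ℂ) ∈ Metric.sphere (0 : ℂ) r)
    (c : ℂ) (hc : c ^ 3 = (M : ℂ) ^ 2) :
    ∃ σ₁ σ₂ : BraidMonodromy.BraidGroup 3 (Metric.closedBall z R)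
        (BraidMonodromy.fiberConf BraidMonodromy.cuspCurve 3 (Metric.closedBall 0 r)
          (Metric.closedBall z R) BraidMonodromy.fiber_cusp_encard_le hD M),
      BraidMonodromy.IsHalfTwist _ (c * BraidMonodromy.ω ^ 2) (c * BraidMonodromy.ω) σ₁ ∧
      BraidMonodromy.IsHalfTwist _ (c * BraidMonodromy.ω) c σ₂ ∧
      BraidMonodromy.braidMonodromy BraidMonodromy.cuspCurve 3 (Metric.closedBall 0 r)
          (Metric.closedBall z R) BraidMonodromy.fiber_cusp_encard_le hD
          (BraidMonodromy.continuous_fiberConf_cusp _ _ hD) M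
          (BraidMonodromy.PiOne.mk (BraidMonodromy.cuspLoop M)) = (σ₁ * σ₂) ^ 2 ∧
      (BraidMonodromy.braidMonodromy BraidMonodromy.cuspCurve 3 (Metric.closedBall 0 r)
          (Metric.closedBall z R) BraidMonodromy.fiber_cusp_encard_le hD
          (BraidMonodromy.continuous_fiberConf_cusp _ _ hD) M).range =
        Subgroup.zpowers ((σ₁ * σ₂) ^ 2) := by
  have hM0 := ne_zero_of_mem M
  have hc0 : c ≠ 0 := by
    rintro rfl
    exact hM0 (by simpa using hc.symm)
  have hcω : c * ω ≠ 0 := mul_ne_zero hc0 ω_ne_zero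
  -- Since `c * ω` is another admissible cube root, `σ₁` is the construction of `σ₂` with `c`
  -- replaced by `c * ω`.
  have hcω3 : (c * ω) ^ 3 = (M : ℂ) ^ 2 := by rw [mul_pow, ω_pow_three, mul_one, hc]
  have hM' : ‖(M : ℂ)‖ = r := mem_sphere_zero_iff_norm.1 hM
  have hball := closedBall_subset_of_cusp hD hM' hc
  have hball' := closedBall_subset_of_cusp hD hM' hcω3
  have hκ : (fiberConf cuspCurve 3 (Metric.closedBall 0 r) _ fiber_cusp_encard_le hD M).1 =
      {c, c * ω, c * ω ^ 2} := fiber_cusp_eq hM0 hc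
  have hκ' : (fiberConf cuspCurve 3 (Metric.closedBall 0 r) _ fiber_cusp_encard_le hD M).1 =
      {c * ω, c * ω * ω, c * ω * ω ^ 2} := fiber_cusp_eq hM0 hcω3
  have hconv : Convex ℝ (Metric.closedBall z R) := convex_closedBall z R
  have h0 : (0 : ℝ) < 1 / 10 := by norm_num
  have hprod : PiOne.mk (twistPath hcω hball' hκ' h0 le_rfl) *
      PiOne.mk (twistPath hc0 hball hκ h0 le_rfl) = PiOne.mk (rotationPath hc0 hball hκ) :=
    congrArg (fun x => MulOpposite.op (FundamentalGroup.fromPath x))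
      (Path.Homotopic.Quotient.eq.2
        (twist_trans_twist_homotopic hconv hc0 hball hκ hcω hball' hκ' h0 le_rfl))
  have hmono : braidMonodromy cuspCurve 3 (Metric.closedBall 0 r) (Metric.closedBall z R)
      fiber_cusp_encard_le hD (continuous_fiberConf_cusp _ _ hD) M (PiOne.mk (cuspLoop M)) =
      (PiOne.mk (twistPath hcω hball' hκ' h0 le_rfl) *
        PiOne.mk (twistPath hc0 hball hκ h0 le_rfl)) ^ 2 := by
    rw [hprod, sq, PiOne.mk_mul_mk, braidMonodromy_mk, cuspLoop_map hD hc0 hball hc hκ]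
  refine ⟨_, _, ?_, isHalfTwist_twistPath hconv hc0 hball hκ h0 le_rfl, hmono, ?_⟩
  · have h := isHalfTwist_twistPath hconv hcω hball' hκ' h0 le_rfl
    rwa [mul_assoc c ω ω, ← sq] at h
  · rw [MonoidHom.range_eq_map, ← zpowers_mk_cuspLoop hr, MonoidHom.map_zpowers, hmono]
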